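/- Let $0<\lambda<\Lambda$. There is a constant $\kappa>0$, depending only on $\lambda$ and $\Lambda$, with the following property. Let $D\subset\mathbb{R}^2$ be a nonempty bounded open set, let $f:\mathbb{R}^2\to\mathbb{R}$ be continuous with $\lambda<f<\Lambda$, and let $g:\partial D\to(0,\infty)$ be continuous. For $v:\mathbb{R}^2\setminus D\to[0,\infty)$ put $\Omega(v)=\{x\in\mathbb{R}^2\setminus D: v(x)>0\}$, with boundary $\partial\Omega(v)$ taken in $\mathbb{R}^2$. Call $v$ a *subsolution* (of the free boundary problem $\Delta v=0$ in $\Omega(v)\setminus D$, $v=g$ on $\partial D$, $v=0$ and $|\nabla v|^2=f$ on $\partial\Omega(v)$) if $v$ is continuous on $\mathbb{R}^2\setminus D$ and 1. $\Delta v\ge 0$ in $\Omega(v)\setminus\overline D$ in the viscosity sense, i.e. every $C^2$ function touching $v$ from above at a point of this set has nonnegative Laplacian there; 2. $v\le g$ on $\partial D$; 3. whenever $x_0\in\partial\Omega(v)$ and $B_s(y)$, $s>0$, is a ball with $B_s(y)\cap\Omega(v)=\emptyset$ and $|x_0-y|=s$, and $\nu=(x_0-y)/s$, then every $\alpha\in\mathbb{R}$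 with $v(x)\le\alpha\langle x-x_0,\nu\rangle^+ +o(|x-x_0|)$ as $x\to x_0$, $x\in\mathbb{R}^2\setminus D$, satisfies $\alpha\ge\sqrt{f(x_0)}$. Fix $p\in D$, $\rho>0$ with $D\subset B_\rho(p)$, and $m>0$; let $$R_0=\inf\Big\{R>\rho:\ \frac{m^2}{R^2\ln^2(\rho/R)}<\lambda\Big\},\qquad h(x)=\Big(\frac{m}{\ln(\rho/R_0)}\,\ln\frac{|x-p|}{R_0}\Big)^+ ,$$ and let $u$ be the largest subsolution below $h$, that is, for $x\in\mathbb{R}^2\setminus D$, $$u(x)=\sup\{v(x):\ v \text{ is a subsolution and } v\le h \text{ on } \mathbb{R}^2\setminus D\}.$$ Then $u$ is non-degenerate: for every $x_0\in\partial\Omega(u)$ and every $r>0$ with $B_r(x_0)\cap D=\emptyset$, $$\sup_{B_r(x_0)}u\ \ge\ \kappa r .$$ -/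

import Mathlib

open Filter Topology

noncomputable section

namespace OnePhaseFBP

/-- The Euclidean plane. -/
abbrev Plane := EuclideanSpace ℝ (Fin 2)

/-- `Ω(v) = {x | v x > 0}` for a function `v` on `ℝ² ∖ D`. Functions on `ℝ² ∖ D` are represented by
functions on the whole plane, whose values on `D` are never used. -/
def posSet (D : Set Plane) (v : Plane → ℝ) : Set Plane :=
  {x | x ∉ D ∧ 0 < v x}

/-- `Δ v ≥ 0` on `U` in the viscosity sense: every `C²` function that touches `v` from above at a
point of `U` has nonnegative Laplacian there. -/
def ViscositySubharmonicOn (v : Plane → ℝ) (U : Set Plane) : Prop :=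
  ∀ x₀ ∈ U, ∀ φ : Plane → ℝ, ContDiffAt ℝ 2 φ x₀ →
    IsLocalMax (fun x => v x - φ x) x₀ → 0 ≤ Laplacian.laplacian φ x₀

/-- The ball `B_s(y)` is tangent from outside to `W` at `x₀`. -/
def IsExteriorTangentBall (W : Set Plane) (x₀ y : Plane) (s : ℝ) : Prop :=
  0 < s ∧ Disjoint (Metric.ball y s) W ∧ dist x₀ y = s

/-- `v(x) ≤ α ⟨x - x₀, ν⟩⁺ + o(|x - x₀|)` as `x → x₀` within `ℝ² ∖ D`. -/
def BelowPlaneAt (D : Set Plane) (v : Plane → ℝ) (x₀ ν : Plane) (α : ℝ) : Prop :=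
  ∀ ε > 0, ∀ᶠ x in 𝓝[Dᶜ] x₀, v x ≤ α * max (inner ℝ (x - x₀) ν) 0 + ε * ‖x - x₀‖

/-- Nonnegative continuous viscosity subsolutions on `ℝ² ∖ D` of
`Δ v = 0` in `Ω(v) ∖ D`, `v = g` on `∂D`, `v = 0` and `|∇ v|² = f` on `∂Ω(v)`.
In `fbc`, the unit vector `(x₀ - y) / s` is the normal at `x₀` pointing away from the exterior
tangent ball `B_s(y)`, that is, into `Ω(v)`. The condition is void at the points of `∂Ω(v)`
where `v > 0` (these lie on `∂D`), since `BelowPlaneAt` forces `v x₀ ≤ 0`. -/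
structure IsSubsolution (D : Set Plane) (f g : Plane → ℝ) (v : Plane → ℝ) : Prop where
  continuousOn : ContinuousOn v Dᶜ
  nonneg : ∀ x ∉ D, 0 ≤ v x
  subharmonic : ViscositySubharmonicOn v (posSet D v \ closure D)
  le_boundary : ∀ x ∈ frontier D, v x ≤ g x
  fbc : ∀ x₀ ∈ frontier (posSet D v), ∀ (y : Plane) (s : ℝ),
    IsExteriorTangentBall (posSet D v) x₀ y s →
      ∀ α : ℝ, BelowPlaneAt D v x₀ (s⁻¹ • (x₀ - y)) α → √(f x₀) ≤ α

/-- `R₀ = inf {R > ρ | m² / (R² ln²(ρ/R)) < lam}`. -/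
def barrierRadius (lam ρ m : ℝ) : ℝ :=
  sInf {R : ℝ | ρ < R ∧ m ^ 2 / (R ^ 2 * Real.log (ρ / R) ^ 2) < lam}

/-- `h(x) = (m / ln(ρ/R₀) · ln(|x - p|/R₀))⁺`: it equals `m` on `∂B_ρ(p)`, vanishes outside
`B_{R₀}(p)`, is harmonic in `B_{R₀}(p) ∖ {p}` and satisfies `|∇ h|² = lam` on `∂B_{R₀}(p)`. -/
def barrier (lam : ℝ) (p : Plane) (ρ m : ℝ) (x : Plane) : ℝ :=
  max (m / Real.log (ρ / barrierRadius lam ρ m) *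
    Real.log (‖x - p‖ / barrierRadius lam ρ m)) 0

/-- The largest subsolution below `h`: the pointwise supremum of all subsolutions `v` with `v ≤ h`
on `ℝ² ∖ D`. -/
def largestSubsolution (D : Set Plane) (f g h : Plane → ℝ) (x : Plane) : ℝ :=
  sSup {t : ℝ | ∃ v : Plane → ℝ, IsSubsolution D f g v ∧ (∀ z ∉ D, v z ≤ h z) ∧ v x = t}

end OnePhaseFBP

end

/-!
Let `u < κ r` on `B_r(x₀)`, and let `v` be an admissible subsolution that does not vanish near `x₀`.
At a point of tangency with an exterior ball of radius `s`, the free boundary condition forces `v`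
to reach the size `c √λ s` at distance comparable to `s`; otherwise a logarithmic barrier lies above
`v` with too small a slope. Hence, on the one hand, an exterior ball of radius comparable to `r`
could be moved, without ever touching `Ω(v)`, until it covers the points near `x₀` where `v > 0`. So
there is no such ball near `x₀`. On the other hand, if every circle `∂B_t(x₀)`, `r/8 ≤ t ≤ r/4`,
left `closure Ω(v)`, it would carry the center of a small exterior tangent ball. Near that ball one
can add to `v` a multiple of the potential of its boundary circle and still lie below a subharmonic
function. By a Vitali covering of the interval `[r/8, r/4]`, disjoint balls of total radius
comparable to `r` would then force `v` to exceed `κ r`.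

So some circle `∂B_t(x₀)` lies in `closure Ω(v)`. Replacing `v` inside it by the harmonic function
with the same boundary values gives an admissible subsolution that is positive on `B_t(x₀)`, and
`x₀` is an interior point of `Ω(u)` rather than a boundary point.
-/

noncomputable section

namespace OnePhaseFBP

open InnerProductSpace Metric Laplacian Real

section Laplacian

variable {E E' : Type*} [NormedAddCommGroup E] [InnerProductSpace ℝ E] [FiniteDimensional ℝ E]
  [NormedAddCommGroup E'] [InnerProductSpace ℝ E'] [FiniteDimensional ℝ E']

theorem laplacian_comp_linearIsometryEquiv (e : E ≃ₗᵢ[ℝ] E') (f : E' → ℝ) (x : E) :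
    Δ (f ∘ e) x = Δ f (e x) := by
  rw [laplacian_eq_iteratedFDeriv_orthonormalBasis (f ∘ e) (stdOrthonormalBasis ℝ E),
    laplacian_eq_iteratedFDeriv_orthonormalBasis f ((stdOrthonormalBasis ℝ E).map e)]
  refine Finset.sum_congr rfl fun i _ ↦ ?_
  have hcomp := e.toContinuousLinearEquiv.iteratedFDerivWithin_comp_right f uniqueDiffOn_univ
    (Set.mem_univ (e x)) 2
  simp only [Set.preimage_univ, iteratedFDerivWithin_univ] at hcomp
  change iteratedFDeriv ℝ 2 (f ∘ e) x = _ at hcomp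
  rw [hcomp, ContinuousMultilinearMap.compContinuousLinearMap_apply]
  congr 1
  ext j
  fin_cases j <;> simp

theorem harmonicAt_comp_linearIsometryEquiv (e : E ≃ₗᵢ[ℝ] E') {f : E' → ℝ} {x : E}
    (h : HarmonicAt f (e x)) : HarmonicAt (f ∘ e) x := by
  refine ⟨h.1.comp x e.toContinuousLinearEquiv.contDiff.contDiffAt, ?_⟩
  filter_upwards [e.continuous.continuousAt.eventually h.2] with z hz
  exact (laplacian_comp_linearIsometryEquiv e f z).trans hz

theorem harmonicContOnCl_comp_linearIsometryEquiv (e : E ≃ₗᵢ[ℝ] E') {f : E' → ℝ} {s : Set E'}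
    (h : HarmonicContOnCl f s) : HarmonicContOnCl (f ∘ e) (e ⁻¹' s) where
  harmonicOnNhd x hx := harmonicAt_comp_linearIsometryEquiv e (h.harmonicOnNhd (e x) hx)
  continuousOn := h.continuousOn.comp e.continuous.continuousOn
    (e.toHomeomorph.preimage_closure s).symm.subset

theorem laplacian_norm_sub_sq (x y : E) :
    Δ (fun z ↦ ‖z - y‖ ^ 2) x = 2 * Module.finrank ℝ E := by
  have hfderiv : fderiv ℝ (fun z ↦ ‖z - y‖ ^ 2) = fun z ↦ (2 • innerSL ℝ : E →L[ℝ] E →L[ℝ] ℝ)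
      (z - y) := funext fun z ↦ ((hasStrictFDerivAt_norm_sq (z - y)).hasFDerivAt.comp z
        ((hasFDerivAt_id z).sub_const y)).fderiv
  have hfderiv₂ : fderiv ℝ (fderiv ℝ fun z ↦ ‖z - y‖ ^ 2) x = 2 • innerSL ℝ := by
    rw [hfderiv]
    exact ((2 • innerSL ℝ : E →L[ℝ] E →L[ℝ] ℝ).hasFDerivAt.comp x
      ((hasFDerivAt_id x).sub_const y)).fderiv
  have hdiag : ∀ v : E, iteratedFDeriv ℝ 2 (fun z ↦ ‖z - y‖ ^ 2) x ![v, v] = 2 * ‖v‖ ^ 2 := by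
    intro v
    rw [iteratedFDeriv_two_apply, hfderiv₂]
    have : innerSL ℝ v v = ‖v‖ ^ 2 := real_inner_self_eq_norm_sq v
    simp [this]
  simp [laplacian_eq_iteratedFDeriv_stdOrthonormalBasis, hdiag, mul_comm]

omit [FiniteDimensional ℝ E] in
theorem contDiffAt_sub_mul_norm_sub_sq {φ : E → ℝ} {x : E} (hφ : ContDiffAt ℝ 2 φ x) (ε : ℝ)
    (y : E) : ContDiffAt ℝ 2 (fun z ↦ φ z - ε * ‖z - y‖ ^ 2) x :=
  hφ.sub (contDiffAt_const.mul ((contDiffAt_id.sub contDiffAt_const).norm_sq ℝ))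

theorem laplacian_sub_mul_norm_sub_sq {φ : E → ℝ} {x : E} (hφ : ContDiffAt ℝ 2 φ x) (ε : ℝ)
    (y : E) : Δ (fun z ↦ φ z - ε * ‖z - y‖ ^ 2) x = Δ φ x - ε * (2 * Module.finrank ℝ E) := by
  have hq : ContDiffAt ℝ 2 (fun z : E ↦ ‖z - y‖ ^ 2) x :=
    (contDiffAt_id.sub contDiffAt_const).norm_sq ℝ
  have hεq : ContDiffAt ℝ 2 (ε • fun z : E ↦ ‖z - y‖ ^ 2) x := hq.const_smul ε
  calc Δ (φ - ε • fun z ↦ ‖z - y‖ ^ 2) x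
      = Δ φ x - ε • Δ (fun z ↦ ‖z - y‖ ^ 2) x := by
        rw [hφ.laplacian_sub hεq, laplacian_smul _ hq]
    _ = _ := by rw [laplacian_norm_sub_sq, smul_eq_mul]

theorem deriv_deriv_nonpos_of_isLocalMax {f : ℝ → ℝ} {a : ℝ} (hf : ContinuousAt f a)
    (hmax : IsLocalMax f a) : deriv (deriv f) a ≤ 0 := by
  by_contra! hpos
  have hmin : IsLocalMin f a := isLocalMin_of_deriv_deriv_pos hpos hmax.deriv_eq_zero hf
  have hconst : f =ᶠ[𝓝 a] fun _ ↦ f a := by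
    filter_upwards [hmax, hmin] with t h₁ h₂ using le_antisymm h₁ h₂
  have : deriv (deriv f) a = 0 := by
    rw [hconst.deriv.deriv_eq]
    simp
  exact hpos.ne' this

omit [FiniteDimensional ℝ E] in
theorem deriv_deriv_comp_add_smul {f : E → ℝ} {x : E} (hf : ContDiffAt ℝ 2 f x) (v : E) :
    deriv (deriv fun t : ℝ ↦ f (x + t • v)) 0 = iteratedFDeriv ℝ 2 f x ![v, v] := by
  have hline : ∀ t : ℝ, HasDerivAt (fun t : ℝ ↦ x + t • v) v t := fun t ↦ by
    have h := ((hasDerivAt_id t).smul_const v).const_add x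
    rwa [one_smul] at h
  have hx : x + (0 : ℝ) • v = x := by simp
  have hdiff : ∀ᶠ z in 𝓝 (x + (0 : ℝ) • v), DifferentiableAt ℝ f z := by
    rw [hx]
    filter_upwards [hf.eventually (by simp)] with z hz using hz.differentiableAt (by simp)
  have hderiv : deriv (fun t : ℝ ↦ f (x + t • v)) =ᶠ[𝓝 0] fun t ↦ fderiv ℝ f (x + t • v) v := by
    filter_upwards [(hline 0).continuousAt.eventually hdiff] with t ht
    exact (ht.hasFDerivAt.comp_hasDerivAt t (hline t)).deriv
  have hfderiv : HasFDerivAt (fderiv ℝ f) (fderiv ℝ (fderiv ℝ f) x) (x + (0 : ℝ) • v) := by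
    rw [hx]
    exact ((hf.fderiv_right (m := 1) (by norm_num)).differentiableAt (by simp)).hasFDerivAt
  have h := (HasFDerivAt.comp_hasDerivAt (f := fun t : ℝ ↦ x + t • v) 0 hfderiv
    (hline 0)).clm_apply (hasDerivAt_const (0 : ℝ) v)
  rw [map_zero, add_zero] at h
  rw [hderiv.deriv_eq, iteratedFDeriv_two_apply]
  exact h.deriv

theorem laplacian_nonpos_of_isLocalMax {f : E → ℝ} {x : E} (hf : ContDiffAt ℝ 2 f x)
    (hmax : IsLocalMax f x) : Δ f x ≤ 0 := by
  rw [laplacian_eq_iteratedFDeriv_stdOrthonormalBasis]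
  refine Finset.sum_nonpos fun i _ ↦ ?_
  have hx : x + (0 : ℝ) • stdOrthonormalBasis ℝ E i = x := by simp
  have hline : ContinuousAt (fun t : ℝ ↦ x + t • stdOrthonormalBasis ℝ E i) 0 := by fun_prop
  rw [← deriv_deriv_comp_add_smul hf]
  refine deriv_deriv_nonpos_of_isLocalMax
    (ContinuousAt.comp (g := f) (by simpa using hf.continuousAt) hline) ?_
  have hmax' : IsLocalMax f (x + (0 : ℝ) • stdOrthonormalBasis ℝ E i) := by rwa [hx]
  exact hline.eventually hmax'

theorem laplacian_nonneg_of_isLocalMin {f : E → ℝ} {x : E} (hf : ContDiffAt ℝ 2 f x)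
    (hmin : IsLocalMin f x) : 0 ≤ Δ f x := by
  have : Δ (-f) x ≤ 0 := laplacian_nonpos_of_isLocalMax hf.neg hmin.neg
  simpa [laplacian_neg] using this

end Laplacian

section PoissonIntegral

variable {c ζ w : ℂ} {R : ℝ} {u v : ℂ → ℝ}

/-- The Poisson integral over the circle of radius `R` about `c`: it solves the Dirichlet problem
in the disc. -/
def poissonIntegral (c : ℂ) (R : ℝ) (v : ℂ → ℝ) (w : ℂ) : ℝ :=
  circleAverage (poissonKernel c w • v) c R

theorem poissonIntegral_eq_of_harmonicContOnCl (hu : HarmonicContOnCl u (ball c R))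
    (hw : w ∈ ball c R) : poissonIntegral c R u w = u w :=
  hu.circleAverage_poissonKernel_smul hw

theorem circleIntegrable_poissonKernel_smul (hv : ContinuousOn v (sphere c R))
    (hw : w ∈ ball c R) : CircleIntegrable (poissonKernel c w • v) c R := by
  have hR : |R| = R := abs_of_pos (pos_of_mem_ball hw)
  have hker := Complex.continuous_re.comp_continuousOn (continuousOn_herglotzRieszKernel_sphere hw)
  rw [hR] at hker
  rw [poissonKernel_eq_re_herglotzRieszKernel]
  exact ContinuousOn.circleIntegrable' (by rw [hR]; exact hker.smul hv)

theorem poissonIntegral_mono (hu : ContinuousOn u (sphere c R)) (hv : ContinuousOn v (sphere c R))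
    (huv : ∀ z ∈ sphere c R, u z ≤ v z) (hw : w ∈ ball c R) :
    poissonIntegral c R u w ≤ poissonIntegral c R v w := by
  have hR : 0 < R := pos_of_mem_ball hw
  refine circleAverage_mono (circleIntegrable_poissonKernel_smul hu hw)
    (circleIntegrable_poissonKernel_smul hv hw) fun z hz ↦ ?_
  rw [abs_of_pos hR] at hz
  have hwR : ‖w - c‖ < R := by rwa [← dist_eq_norm]
  have hker : 0 ≤ poissonKernel c w z := by
    rw [poissonKernel_eq_re_herglotzRieszKernel]
    exact (div_nonneg (sub_nonneg.2 hwR.le) (by positivity)).trans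
      (le_re_herglotzRieszKernel hz hw)
  exact mul_le_mul_of_nonneg_left (huv z hz) hker

theorem poissonIntegral_neg (c : ℂ) (R : ℝ) (v : ℂ → ℝ) (w : ℂ) :
    poissonIntegral c R (-v) w = -poissonIntegral c R v w := by
  have := circleAverage_smul (a := (-1 : ℝ)) (f := poissonKernel c w • v) (c := c) (R := R)
  simpa [poissonIntegral] using this

theorem harmonicOnNhd_poissonIntegral (hv : ContinuousOn v (sphere c R)) :
    HarmonicOnNhd (poissonIntegral c R v) (ball c R) := by
  intro w hw
  have hR : 0 < R := pos_of_mem_ball hw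
  have hcont : ContinuousOn (fun z ↦ v (z + c)) (sphere 0 |R|) :=
    hv.comp (by fun_prop) fun z hz ↦ by simpa [abs_of_pos hR] using hz
  have hcontC : ContinuousOn (fun z ↦ (v (z + c) : ℂ)) (sphere 0 |R|) :=
    Complex.continuous_ofReal.comp_continuousOn hcont
  have hball : ∀ z ∈ ball c R, z - c ∈ ball 0 R := fun z hz ↦ by simpa [dist_eq_norm] using hz
  have hanalytic : AnalyticAt ℂ (fun z ↦ circleAverage
      (fun ζ ↦ herglotzRieszKernel 0 (z - c) ζ • (v (ζ + c) : ℂ)) 0 R) w :=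
    (analyticOnNhd_circleAverage_herglotzRieszKernel_smul hcontC.circleIntegrable' (w - c)
      (hball w hw)).comp (f := fun z ↦ z - c) (by fun_prop)
  refine (harmonicAt_congr_nhds ?_).1 hanalytic.harmonicAt_re
  filter_upwards [isOpen_ball.mem_nhds hw] with z hz
  rw [re_circleAverage_herglotzRieszKernel_smul hcont.circleIntegrable' (hball z hz),
    poissonIntegral, ← circleAverage_map_add_const (c := c),
    poissonKernel_eq_re_herglotzRieszKernel]
  simp only [Pi.smul_def', Function.comp_apply, herglotzRieszKernel_add_const]

/-- The harmonic function that agrees with `‖z - ζ‖ ^ 2` on the circle of radius `R` about `c`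
through `ζ`. -/
def circleBarrier (c ζ : ℂ) (R : ℝ) (z : ℂ) : ℝ :=
  2 * (R ^ 2 - ((z - c) * (starRingEnd ℂ) (ζ - c)).re)

theorem circleBarrier_eq_norm_sub_sq {z : ℂ} (hζ : ζ ∈ sphere c R) (hz : z ∈ sphere c R) :
    circleBarrier c ζ R z = ‖z - ζ‖ ^ 2 := by
  rw [mem_sphere, dist_eq_norm] at hζ hz
  rw [circleBarrier, show z - ζ = (z - c) - (ζ - c) by ring, Complex.sq_norm, Complex.normSq_sub,
    ← Complex.sq_norm, ← Complex.sq_norm, hζ, hz]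
  ring

theorem harmonicAt_circleBarrier (c ζ : ℂ) (R : ℝ) (z : ℂ) :
    HarmonicAt (circleBarrier c ζ R) z := by
  have h : AnalyticAt ℂ (fun z ↦ 2 * ((R : ℂ) ^ 2 - (z - c) * (starRingEnd ℂ) (ζ - c))) z := by
    fun_prop
  convert h.harmonicAt_re using 2 with z
  simp [circleBarrier, ← Complex.ofReal_pow]

theorem le_add_mul_circleBarrier_of_lt (hv : ContinuousOn v (sphere c R)) (hζ : ζ ∈ sphere c R)
    {a : ℝ} (ha : v ζ < a) : ∃ K, ∀ z ∈ sphere c R, v z ≤ a + K * circleBarrier c ζ R z := by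
  obtain ⟨δ, hδ, hnear⟩ := Metric.mem_nhdsWithin_iff.1 ((hv ζ hζ).eventually_lt_const ha)
  obtain ⟨M, hM⟩ := (isCompact_sphere c R).exists_bound_of_continuousOn hv
  refine ⟨(M + |a|) / δ ^ 2, fun z hz ↦ ?_⟩
  have hM₀ : 0 ≤ M + |a| := add_nonneg ((norm_nonneg _).trans (hM z hz)) (abs_nonneg a)
  rw [circleBarrier_eq_norm_sub_sq hζ hz]
  rcases lt_or_ge ‖z - ζ‖ δ with h | h
  · have hlt : v z < a := hnear ⟨by rwa [mem_ball, dist_eq_norm], hz⟩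
    have : 0 ≤ (M + |a|) / δ ^ 2 * ‖z - ζ‖ ^ 2 := by positivity
    linarith
  · have hfar : M + |a| ≤ (M + |a|) / δ ^ 2 * ‖z - ζ‖ ^ 2 := by
      rw [div_mul_eq_mul_div, le_div_iff₀ (by positivity)]
      gcongr
    linarith [(le_abs_self (v z)).trans (hM z hz), neg_abs_le a]

theorem eventually_poissonIntegral_lt (hv : ContinuousOn v (sphere c R)) (hζ : ζ ∈ sphere c R)
    {b : ℝ} (hb : v ζ < b) : ∀ᶠ w in 𝓝[ball c R] ζ, poissonIntegral c R v w < b := by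
  obtain ⟨a, hva, hab⟩ := exists_between hb
  obtain ⟨K, hK⟩ := le_add_mul_circleBarrier_of_lt hv hζ hva
  have hharm : HarmonicOnNhd (fun z ↦ a + K * circleBarrier c ζ R z) Set.univ := fun z _ ↦
    HarmonicAt.add (harmonicAt_const a) (HarmonicAt.const_smul (harmonicAt_circleBarrier c ζ R z))
  have hcont : Continuous fun z ↦ a + K * circleBarrier c ζ R z :=
    continuousOn_univ.1 hharm.continuousOn
  have hζb : a + K * circleBarrier c ζ R ζ < b := by
    simpa [circleBarrier_eq_norm_sub_sq hζ hζ] using hab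
  filter_upwards [mem_nhdsWithin_of_mem_nhds (hcont.continuousAt.eventually_lt_const hζb),
    self_mem_nhdsWithin] with w hwb hw
  calc poissonIntegral c R v w
      ≤ poissonIntegral c R (fun z ↦ a + K * circleBarrier c ζ R z) w :=
        poissonIntegral_mono hv hcont.continuousOn hK hw
    _ = a + K * circleBarrier c ζ R w := poissonIntegral_eq_of_harmonicContOnCl
        ⟨hharm.mono (Set.subset_univ _), hcont.continuousOn⟩ hw
    _ < b := hwb

theorem tendsto_poissonIntegral (hv : ContinuousOn v (sphere c R)) (hζ : ζ ∈ sphere c R) :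
    Tendsto (poissonIntegral c R v) (𝓝[ball c R] ζ) (𝓝 (v ζ)) := by
  refine tendsto_order.2 ⟨fun a ha ↦ ?_, fun b hb ↦ eventually_poissonIntegral_lt hv hζ hb⟩
  filter_upwards [eventually_poissonIntegral_lt hv.neg hζ (neg_lt_neg ha)] with w hw
  rw [poissonIntegral_neg] at hw
  exact neg_lt_neg_iff.1 hw

theorem exists_harmonicContOnCl_eqOn_sphere_complex (hv : ContinuousOn v (sphere c R)) :
    ∃ H, HarmonicContOnCl H (ball c R) ∧ Set.EqOn H v (sphere c R) := by
  classical
  set H : ℂ → ℝ := fun z ↦ if z ∈ ball c R then poissonIntegral c R v z else v z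
  have hball : Set.EqOn H (poissonIntegral c R v) (ball c R) := fun z hz ↦ if_pos hz
  have hsphere : Set.EqOn H v (sphere c R) := fun z hz ↦
    if_neg (sphere_disjoint_ball.notMem_of_mem_left hz)
  have hharm : HarmonicOnNhd H (ball c R) := fun z hz ↦ (harmonicAt_congr_nhds
    (hball.eventuallyEq_of_mem (isOpen_ball.mem_nhds hz))).2 (harmonicOnNhd_poissonIntegral hv z hz)
  refine ⟨H, HarmonicContOnCl.mk_ball hharm ?_, hsphere⟩
  rw [← ball_union_sphere]
  rintro z (hz | hz)
  · exact (hharm z hz).1.continuousAt.continuousWithinAt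
  · rw [ContinuousWithinAt, nhdsWithin_union, hsphere hz, tendsto_sup]
    exact ⟨(tendsto_poissonIntegral hv hz).congr' (eventually_nhdsWithin_of_forall
      fun w hw ↦ (hball hw).symm), (hv z hz).congr' (eventually_nhdsWithin_of_forall
      fun w hw ↦ (hsphere hw).symm)⟩

theorem harnack_complex (hu : HarmonicContOnCl u (ball c R)) (h₀ : ∀ z ∈ sphere c R, 0 ≤ u z)
    (hw : w ∈ ball c R) :
    (R - ‖w - c‖) / (R + ‖w - c‖) * u c ≤ u w ∧ u w ≤ (R + ‖w - c‖) / (R - ‖w - c‖) * u c := by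
  have hR : |R| = R := abs_of_pos (pos_of_mem_ball hw)
  have hcont : ContinuousOn u (sphere c R) := hu.continuousOn_ball.mono sphere_subset_closedBall
  have hint : CircleIntegrable (poissonKernel c w • u) c R :=
    circleIntegrable_poissonKernel_smul hcont hw
  have hint_smul : ∀ a : ℝ, CircleIntegrable (a • u) c R := fun a ↦
    ContinuousOn.circleIntegrable' (by rw [hR]; exact hcont.const_smul a)
  have hc : circleAverage u c R = u c :=
    InnerProductSpace.HarmonicContOnCl.circleAverage_eq (by rwa [hR])
  rw [← hu.circleAverage_poissonKernel_smul hw, ← hc, ← smul_eq_mul, ← smul_eq_mul,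
    ← circleAverage_smul, ← circleAverage_smul]
  constructor
  · refine circleAverage_mono (hint_smul _) hint fun z hz ↦ ?_
    rw [hR] at hz
    rw [poissonKernel_eq_re_herglotzRieszKernel]
    exact mul_le_mul_of_nonneg_right (le_re_herglotzRieszKernel hz hw) (h₀ z hz)
  · refine circleAverage_mono hint (hint_smul _) fun z hz ↦ ?_
    rw [hR] at hz
    rw [poissonKernel_eq_re_herglotzRieszKernel]
    exact mul_le_mul_of_nonneg_right (re_herglotzRieszKernel_le hz hw) (h₀ z hz)

end PoissonIntegral

section Plane

/-- The standard identification of the plane with `ℂ`. -/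
def toComplex : Plane ≃ₗᵢ[ℝ] ℂ := Complex.orthonormalBasisOneI.repr.symm

theorem harmonicAt_log_norm_sub {x y : Plane} (h : x ≠ y) :
    HarmonicAt (fun z ↦ log ‖z - y‖) x := by
  have hlog : HarmonicAt (fun w : ℂ ↦ log ‖w - toComplex y‖) (toComplex x) :=
    AnalyticAt.harmonicAt_log_norm (f := fun w ↦ w - toComplex y) (by fun_prop)
      (by simpa [sub_eq_zero] using h)
  convert harmonicAt_comp_linearIsometryEquiv toComplex hlog using 2 with z
  simp [← map_sub]

theorem harmonicAt_const_mul_log_norm_sub {x y : Plane} (h : x ≠ y) (a : ℝ) :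
    HarmonicAt (fun z ↦ a * log ‖z - y‖) x :=
  HarmonicAt.const_smul (c := a) (harmonicAt_log_norm_sub h)

theorem exists_harmonicContOnCl_eqOn_sphere {v : Plane → ℝ} {y : Plane} {R : ℝ}
    (hv : ContinuousOn v (sphere y R)) :
    ∃ H, HarmonicContOnCl H (ball y R) ∧ Set.EqOn H v (sphere y R) := by
  obtain ⟨H, hH, hHv⟩ := exists_harmonicContOnCl_eqOn_sphere_complex
    (v := v ∘ toComplex.symm) (c := toComplex y)
    (hv.comp toComplex.symm.continuous.continuousOn fun z hz ↦ by
      rwa [← Set.mem_preimage, toComplex.symm.preimage_sphere])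
  refine ⟨H ∘ toComplex, ?_, fun z hz ↦ ?_⟩
  · simpa using harmonicContOnCl_comp_linearIsometryEquiv toComplex hH
  · have hz' : toComplex z ∈ sphere (toComplex y) R := by rwa [mem_sphere, toComplex.dist_map]
    simpa using hHv hz'

theorem harnack {Φ : Plane → ℝ} {c w : Plane} {R : ℝ} (hΦ : HarmonicContOnCl Φ (ball c R))
    (h₀ : ∀ z ∈ sphere c R, 0 ≤ Φ z) (hw : w ∈ ball c R) :
    (R - ‖w - c‖) / (R + ‖w - c‖) * Φ c ≤ Φ w ∧
      Φ w ≤ (R + ‖w - c‖) / (R - ‖w - c‖) * Φ c := by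
  have hΦ' : HarmonicContOnCl (Φ ∘ toComplex.symm) (ball (toComplex c) R) := by
    simpa using harmonicContOnCl_comp_linearIsometryEquiv toComplex.symm hΦ
  have := harnack_complex hΦ' (w := toComplex w)
    (fun z hz ↦ h₀ _ (by rwa [← Set.mem_preimage, toComplex.symm.preimage_sphere]))
    (by simpa using hw)
  simpa [← map_sub] using this

end Plane

section ViscositySubharmonicOn

variable {v H φ ψ : Plane → ℝ} {U V K : Set Plane}

theorem ViscositySubharmonicOn.mono (hv : ViscositySubharmonicOn v U) (hVU : V ⊆ U) :
    ViscositySubharmonicOn v V :=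
  fun x hx ↦ hv x (hVU hx)

theorem ViscositySubharmonicOn.of_nonneg (hU : IsOpen U) (hv₀ : ∀ x ∈ U, 0 ≤ v x)
    (hv : ViscositySubharmonicOn v {x ∈ U | 0 < v x}) : ViscositySubharmonicOn v U := by
  intro x hx φ hφ hmax
  rcases (hv₀ x hx).lt_or_eq with hpos | hzero
  · exact hv x ⟨hx, hpos⟩ φ hφ hmax
  · -- `φ` touches from above at a zero of `v ≥ 0`, so it has a local minimum there.
    refine laplacian_nonneg_of_isLocalMin hφ ?_
    filter_upwards [hmax, hU.mem_nhds hx] with z hz hzU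
    linarith [hv₀ z hzU]

theorem ViscositySubharmonicOn.add_harmonicOnNhd (hv : ViscositySubharmonicOn v U)
    (hψ : HarmonicOnNhd ψ U) : ViscositySubharmonicOn (v + ψ) U := by
  intro x hx φ hφ hmax
  have hψφ : ContDiffAt ℝ 2 (φ - ψ) x := hφ.sub (hψ x hx).1
  have h : 0 ≤ Δ (φ - ψ) x := hv x hx _ hψφ <| by
    filter_upwards [hmax] with z hz
    simp only [Pi.add_apply, Pi.sub_apply] at hz ⊢
    linarith
  rwa [hφ.laplacian_sub (hψ x hx).1, (hψ x hx).2.eq_of_nhds, Pi.zero_apply, sub_zero] at h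

theorem viscositySubharmonicOn_of_harmonicOnNhd (hψ : HarmonicOnNhd ψ U) :
    ViscositySubharmonicOn ψ U := by
  have hzero : ViscositySubharmonicOn 0 U := fun x _ φ hφ hmax ↦
    laplacian_nonneg_of_isLocalMin hφ (by simpa [IsLocalMax, IsLocalMin] using hmax.neg)
  simpa using hzero.add_harmonicOnNhd hψ

open Classical in
theorem ViscositySubharmonicOn.piecewise (hv : ViscositySubharmonicOn v (U \ V))
    (hH : ViscositySubharmonicOn H (U ∩ V)) (hU : IsOpen U) (hV : IsOpen V)
    (hle : ∀ x ∈ U ∩ V, v x ≤ H x) : ViscositySubharmonicOn (V.piecewise H v) U := by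
  intro x hx φ hφ hmax
  by_cases hxV : x ∈ V
  · refine hH x ⟨hx, hxV⟩ φ hφ (hmax.congr ?_)
    filter_upwards [hV.mem_nhds hxV] with z hz
    rw [V.piecewise_eq_of_mem _ _ hz]
  · have hle' : ∀ z ∈ U, v z ≤ V.piecewise H v z := fun z hz ↦ by
      by_cases hzV : z ∈ V
      · exact (hle z ⟨hz, hzV⟩).trans_eq (V.piecewise_eq_of_mem _ _ hzV).symm
      · exact (V.piecewise_eq_of_notMem _ _ hzV).ge
    refine hv x ⟨hx, hxV⟩ φ hφ ?_
    filter_upwards [hmax, hU.mem_nhds hx] with z hz hzU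
    rw [V.piecewise_eq_of_notMem _ _ hxV] at hz
    linarith [hle' z hzU]

theorem ViscositySubharmonicOn.le_of_le_diff {M : ℝ} (hv : ViscositySubharmonicOn v U)
    (hK : IsCompact K) (hU : IsOpen U) (hUK : U ⊆ K) (hcont : ContinuousOn v K)
    (hle : ∀ x ∈ K \ U, v x ≤ M) : ∀ x ∈ K, v x ≤ M := by
  intro z hz
  by_contra! hlt
  obtain ⟨C, hC⟩ := hK.isBounded.exists_norm_le
  -- `v + ε‖·‖²` still has an interior maximum, and the paraboloid `-ε‖·‖²` touches `v` there.
  obtain ⟨ε, hε, hεC⟩ : ∃ ε > 0, ε * (C ^ 2 + 1) = v z - M :=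
    ⟨_, div_pos (sub_pos.2 hlt) (by positivity), div_mul_cancel₀ _ (by positivity)⟩
  obtain ⟨x, hxK, hx⟩ := hK.exists_isMaxOn ⟨z, hz⟩
    (f := fun x ↦ v x - ((0 : ℝ) - ε * ‖x - 0‖ ^ 2)) (by fun_prop)
  have hxz : v z + ε * ‖z‖ ^ 2 ≤ v x + ε * ‖x‖ ^ 2 := by
    have := hx hz
    simp only [Set.mem_ofPred_eq, sub_zero] at this
    linarith
  have hxU : x ∈ U := by
    by_contra hxU
    have hxM : v x ≤ M := hle x ⟨hxK, hxU⟩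
    have hxC : ε * ‖x‖ ^ 2 ≤ ε * C ^ 2 := by
      gcongr
      exact hC x hxK
    have : 0 ≤ ε * ‖z‖ ^ 2 := by positivity
    linarith
  have hΔ := hv x hxU _ (contDiffAt_sub_mul_norm_sub_sq contDiffAt_const ε 0)
    (hx.isLocalMax (mem_of_superset (hU.mem_nhds hxU) hUK))
  rw [laplacian_sub_mul_norm_sub_sq contDiffAt_const, laplacian_const] at hΔ
  simp at hΔ
  linarith

theorem ViscositySubharmonicOn.le_of_le_sphere {y : Plane} {R M : ℝ}
    (hv : ViscositySubharmonicOn v (ball y R)) (hcont : ContinuousOn v (closedBall y R))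
    (hle : ∀ x ∈ sphere y R, v x ≤ M) : ∀ x ∈ closedBall y R, v x ≤ M :=
  hv.le_of_le_diff (isCompact_closedBall y R) isOpen_ball ball_subset_closedBall hcont fun x hx ↦
    hle x (by rwa [closedBall_sdiff_ball] at hx)

theorem ViscositySubharmonicOn.le_harmonic_of_le_sphere {y : Plane} {R : ℝ}
    (hv : ViscositySubharmonicOn v (ball y R)) (hcont : ContinuousOn v (closedBall y R))
    (hφ : HarmonicContOnCl φ (ball y R)) (hle : ∀ x ∈ sphere y R, v x ≤ φ x) :
    ∀ x ∈ closedBall y R, v x ≤ φ x := fun x hx ↦ by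
  have h := (hv.add_harmonicOnNhd hφ.harmonicOnNhd.neg).le_of_le_sphere
    (hcont.add hφ.continuousOn_ball.neg) (M := 0) (fun z hz ↦ by simpa using hle z hz) x hx
  simpa using h

open Classical in
theorem continuousOn_piecewise_ball {y : Plane} {R : ℝ}
    (hH : ContinuousOn H (closedBall y R)) (hv : ContinuousOn v K)
    (heq : Set.EqOn H v (sphere y R)) : ContinuousOn ((ball y R).piecewise H v) K := by
  refine ContinuousOn.piecewise (fun x hx ↦ heq (frontier_ball_subset_sphere hx.2))
    (hH.mono fun x hx ↦ closure_ball_subset_closedBall hx.2) (hv.mono Set.inter_subset_left)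

end ViscositySubharmonicOn

section CappedLog

variable {v H ψ : Plane → ℝ} {x y : Plane} {a s R : ℝ}

/-- The logarithmic potential of a unit mass spread over the circle of radius `s` about `y`,
normalized to vanish at distance `R > s` from `y`. -/
def cappedLog (R s : ℝ) (y x : Plane) : ℝ := log R - log (max ‖x - y‖ s)

theorem cappedLog_of_le (h : ‖x - y‖ ≤ s) : cappedLog R s y x = log R - log s := by
  rw [cappedLog, max_eq_right h]

theorem cappedLog_of_norm_sub_eq (h : ‖x - y‖ = R) (hsR : s ≤ R) : cappedLog R s y x = 0 := by
  rw [cappedLog, h, max_eq_left hsR, sub_self]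

theorem cappedLog_nonpos (hR : 0 < R) (h : R ≤ ‖x - y‖) : cappedLog R s y x ≤ 0 :=
  sub_nonpos.2 (log_le_log hR (h.trans (le_max_left _ _)))

theorem log_le_cappedLog {b : ℝ} (hb : 0 < b) (hs : 0 < s) (hsR : b * s ≤ R)
    (h : b * ‖x - y‖ ≤ R) : log b ≤ cappedLog R s y x := by
  have hpos : 0 < max ‖x - y‖ s := lt_max_of_lt_right hs
  rw [cappedLog, le_sub_iff_add_le, ← log_mul hb.ne' hpos.ne', mul_max_of_nonneg _ _ hb.le]
  exact log_le_log (by positivity) (max_le h hsR)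

theorem continuous_cappedLog (hs : 0 < s) : Continuous (cappedLog R s y) :=
  continuous_const.sub <| Continuous.log (by fun_prop) fun _ ↦ (lt_max_of_lt_right hs).ne'

theorem harmonicAt_const_mul_cappedLog (hs : 0 ≤ s) (h : s < ‖x - y‖) (a : ℝ) :
    HarmonicAt (fun z ↦ a * cappedLog R s y z) x := by
  have hne : x ≠ y := sub_ne_zero.1 (norm_pos_iff.1 (hs.trans_lt h))
  refine (harmonicAt_congr_nhds ?_).1
    (HarmonicAt.add (harmonicAt_const (a * log R)) (harmonicAt_const_mul_log_norm_sub hne (-a)))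
  have hcont : ContinuousAt (fun z : Plane ↦ ‖z - y‖) x := by fun_prop
  filter_upwards [hcont.eventually_const_lt h] with z hz
  simp only [Pi.add_apply, cappedLog, max_eq_left hz.le]
  ring

theorem ViscositySubharmonicOn.add_cappedLog_le (hs : 0 < s)
    (hcont : ContinuousOn v (closedBall y R)) (hv : ViscositySubharmonicOn v (ball y R))
    (hv₀ : ∀ x ∈ closedBall y s, v x ≤ 0) (hH : HarmonicContOnCl H (ball y R))
    (hvH : ∀ x ∈ sphere y R, v x ≤ H x)
    (hHs : ∀ x ∈ closedBall y s, a * (log R - log s) ≤ H x) :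
    ∀ x ∈ closedBall y R, v x + a * cappedLog R s y x ≤ H x := by
  have hpot : ContinuousOn (fun x ↦ a * cappedLog R s y x) (closedBall y R) :=
    ((continuous_cappedLog hs).const_mul a).continuousOn
  have hsub : ViscositySubharmonicOn (v + (fun x ↦ a * cappedLog R s y x) + -H)
      (ball y R \ closedBall y s) := by
    refine ((hv.mono Set.sdiff_subset).add_harmonicOnNhd fun x hx ↦ ?_).add_harmonicOnNhd
      (hH.harmonicOnNhd.neg.mono Set.sdiff_subset)
    exact harmonicAt_const_mul_cappedLog hs.le (by simpa [dist_eq_norm] using hx.2) a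
  suffices ∀ x ∈ closedBall y R, (v + (fun x ↦ a * cappedLog R s y x) + -H) x ≤ 0 from
    fun x hx ↦ by simpa using this x hx
  refine hsub.le_of_le_diff (isCompact_closedBall y R) (isOpen_ball.sdiff isClosed_closedBall)
    (Set.sdiff_subset.trans ball_subset_closedBall)
    ((hcont.add hpot).add hH.continuousOn_ball.neg) fun x hx ↦ ?_
  simp only [Pi.add_apply, Pi.neg_apply]
  by_cases hxs : x ∈ closedBall y s
  · rw [cappedLog_of_le (by simpa [dist_eq_norm] using hxs)]
    linarith [hv₀ x hxs, hHs x hxs]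
  · have hxR : x ∈ sphere y R := by
      rw [← closedBall_sdiff_ball]
      exact ⟨hx.1, fun h ↦ hx.2 ⟨h, hxs⟩⟩
    rw [mem_sphere, dist_eq_norm] at hxR
    have hsR : s ≤ R := hxR ▸ (by simpa [dist_eq_norm] using hxs : s < ‖x - y‖).le
    rw [cappedLog_of_norm_sub_eq hxR hsR]
    linarith [hvH x (by rwa [mem_sphere, dist_eq_norm])]

/-- The potential `a * cappedLog R s y` can be added to `v` in the ball of radius `R` about `y`
without leaving the functions that lie below a subharmonic function with the boundary values
of `v`. -/
def AbsorbsPotential (v : Plane → ℝ) (a s R : ℝ) (y : Plane) : Prop :=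
  ∃ H, ContinuousOn H (closedBall y R) ∧ ViscositySubharmonicOn H (ball y R) ∧
    Set.EqOn H v (sphere y R) ∧ ∀ x ∈ closedBall y R, v x + a * cappedLog R s y x ≤ H x

theorem AbsorbsPotential.add_harmonicOnNhd (hv : AbsorbsPotential v a s R y)
    (hψ : HarmonicOnNhd ψ (closedBall y R)) : AbsorbsPotential (v + ψ) a s R y := by
  obtain ⟨H, hHc, hHsub, hHv, hle⟩ := hv
  refine ⟨H + ψ, hHc.add hψ.continuousOn,
    hHsub.add_harmonicOnNhd (hψ.mono ball_subset_closedBall), fun x hx ↦ ?_, fun x hx ↦ ?_⟩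
  · rw [Pi.add_apply, hHv hx, Pi.add_apply]
  · simp only [Pi.add_apply]
    linarith [hle x hx]

theorem AbsorbsPotential.congr {w : Plane → ℝ} (hv : AbsorbsPotential v a s R y)
    (hvw : Set.EqOn w v (closedBall y R)) : AbsorbsPotential w a s R y := by
  obtain ⟨H, hHc, hHsub, hHv, hle⟩ := hv
  refine ⟨H, hHc, hHsub, fun x hx ↦ ?_, fun x hx ↦ ?_⟩
  · rw [hHv hx, hvw (sphere_subset_closedBall hx)]
  · rw [hvw hx]
    exact hle x hx

theorem AbsorbsPotential.exists_subharmonic_majorant {K U : Set Plane}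
    (hv : AbsorbsPotential v a s R y) (hs : 0 < s) (hsR : s < R) (hcont : ContinuousOn v K)
    (hsub : ViscositySubharmonicOn v U) (hU : IsOpen U) (R' : ℝ) :
    ∃ W, ContinuousOn W K ∧ ViscositySubharmonicOn W U ∧
      (∀ x, v x + a * cappedLog R' s y x ≤ W x) ∧
      ∀ x ∉ ball y R, W x = v x + a * cappedLog R' s y x := by
  classical
  obtain ⟨H, hHc, hHsub, hHv, hle⟩ := hv
  set k : ℝ := a * (log R' - log R)
  have hk : ∀ x, a * cappedLog R' s y x = a * cappedLog R s y x + k := fun x ↦ by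
    simp only [k, cappedLog]
    ring
  have hmaj : ∀ x ∈ closedBall y R, v x + a * cappedLog R' s y x ≤ H x + k := fun x hx ↦ by
    linarith [hle x hx, hk x]
  have hout : ViscositySubharmonicOn (v + fun x ↦ a * cappedLog R' s y x) (U \ ball y R) :=
    (hsub.mono Set.sdiff_subset).add_harmonicOnNhd fun x hx ↦
      harmonicAt_const_mul_cappedLog hs.le (hsR.trans_le (by simpa [dist_eq_norm] using hx.2)) a
  have hin : ViscositySubharmonicOn (H + fun _ ↦ k) (U ∩ ball y R) :=
    (hHsub.mono Set.inter_subset_right).add_harmonicOnNhd (harmonicOnNhd_const k)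
  refine ⟨(ball y R).piecewise (H + fun _ ↦ k) (v + fun x ↦ a * cappedLog R' s y x),
    continuousOn_piecewise_ball (hHc.add continuousOn_const)
      (hcont.add ((continuous_cappedLog hs).const_mul a).continuousOn) fun x hx ↦ ?_,
    hout.piecewise hin hU isOpen_ball fun x hx ↦ hmaj x (ball_subset_closedBall hx.2),
    fun x ↦ ?_, fun x hx ↦ Set.piecewise_eq_of_notMem _ _ _ hx⟩
  · rw [mem_sphere, dist_eq_norm] at hx
    simp only [Pi.add_apply, hk x, cappedLog_of_norm_sub_eq hx hsR.le,
      hHv (by rwa [mem_sphere, dist_eq_norm]), mul_zero, zero_add]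
  · by_cases hx : x ∈ ball y R
    · rw [Set.piecewise_eq_of_mem _ _ _ hx]
      exact hmaj x (ball_subset_closedBall hx)
    · rw [Set.piecewise_eq_of_notMem _ _ _ hx]
      exact le_rfl

theorem ViscositySubharmonicOn.add_sum_cappedLog_le {ι : Type*} {J : Finset ι}
    {y : ι → Plane} {a s R : ι → ℝ} {x₀ : Plane} {ρ R' M : ℝ} (hs : ∀ i ∈ J, 0 < s i)
    (hsR : ∀ i ∈ J, s i < R i)
    (hdisj : (J : Set ι).PairwiseDisjoint fun i ↦ closedBall (y i) (R i))
    (hsub : ∀ i ∈ J, ball (y i) (R i) ⊆ ball x₀ ρ) (hcont : ContinuousOn v (closedBall x₀ ρ))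
    (hv : ViscositySubharmonicOn v (ball x₀ ρ))
    (habs : ∀ i ∈ J, AbsorbsPotential v (a i) (s i) (R i) (y i))
    (hM : ∀ x ∈ sphere x₀ ρ, v x + ∑ i ∈ J, a i * cappedLog R' (s i) (y i) x ≤ M) :
    ∀ x ∈ closedBall x₀ ρ, v x + ∑ i ∈ J, a i * cappedLog R' (s i) (y i) x ≤ M := by
  classical
  induction J using Finset.induction_on generalizing v with
  | empty => simpa using hv.le_of_le_sphere hcont (by simpa using hM)
  | insert i J hi ih =>
    have hiJ : i ∈ insert i J := Finset.mem_insert_self i J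
    have hJ : ∀ j ∈ J, j ∈ insert i J := fun j ↦ Finset.mem_insert_of_mem
    obtain ⟨W, hWc, hWsub, hle, heq⟩ := (habs i hiJ).exists_subharmonic_majorant (hs i hiJ)
      (hsR i hiJ) hcont hv isOpen_ball R'
    have hWabs : ∀ j ∈ J, AbsorbsPotential W (a j) (s j) (R j) (y j) := fun j hj ↦ by
      have hji : Disjoint (closedBall (y j) (R j)) (closedBall (y i) (R i)) :=
        hdisj (by simp [hj]) (by simp) (by rintro rfl; exact hi hj)
      have hfar : ∀ x ∈ closedBall (y j) (R j), x ∉ ball (y i) (R i) := fun x hx hxi ↦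
        hji.notMem_of_mem_left hx (ball_subset_closedBall hxi)
      refine ((habs j (hJ j hj)).add_harmonicOnNhd fun x hx ↦
        harmonicAt_const_mul_cappedLog (hs i hiJ).le ?_ (a i)).congr fun x hx ↦ heq x (hfar x hx)
      exact (hsR i hiJ).trans_le (by simpa [dist_eq_norm] using hfar x hx)
    have hWM := ih (fun j hj ↦ hs j (hJ j hj)) (fun j hj ↦ hsR j (hJ j hj))
      (hdisj.subset (by simp)) (fun j hj ↦ hsub j (hJ j hj))
      hWc hWsub hWabs fun x hx ↦ by
        have hxi : x ∉ ball (y i) (R i) := fun h ↦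
          sphere_disjoint_ball.notMem_of_mem_left hx (hsub i hiJ h)
        have := hM x hx
        rw [Finset.sum_insert hi] at this
        linarith [heq x hxi]
    intro x hx
    rw [Finset.sum_insert hi]
    linarith [hWM x hx, hle x]

end CappedLog

section ExteriorTangentBall

variable {D W : Set Plane} {f g v : Plane → ℝ} {lam s : ℝ} {x₁ y z : Plane}

theorem mem_frontier_of_disjoint_ball (hs : 0 < s) (hW : Disjoint (ball y s) W)
    (hz : z ∈ closedBall y s) (hzW : z ∈ closure W) : z ∈ frontier W ∧ dist z y = s := by
  refine ⟨⟨hzW, fun hint ↦ ?_⟩, le_antisymm hz (not_lt.1 fun h ↦ ?_)⟩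
  · rw [← closure_ball y hs.ne'] at hz
    obtain ⟨w, hw, hwy⟩ := mem_closure_iff.1 hz _ isOpen_interior hint
    exact hW.notMem_of_mem_left hwy (interior_subset hw)
  · exact (hW.closure_right isOpen_ball).notMem_of_mem_left (mem_ball.2 h) hzW

theorem norm_sub_le_add_inner_add_sq {E : Type*} [NormedAddCommGroup E] [InnerProductSpace ℝ E]
    {x x₁ y : E} (hs : 0 < s) (hx₁ : ‖x₁ - y‖ = s) :
    ‖x - y‖ ≤ s + inner ℝ (x - x₁) (s⁻¹ • (x₁ - y)) + ‖x - x₁‖ ^ 2 / (2 * s) := by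
  have hsq : ‖x - y‖ ^ 2 = ‖x - x₁‖ ^ 2 + 2 * inner ℝ (x - x₁) (x₁ - y) + s ^ 2 := by
    rw [← hx₁, ← norm_add_sq_real, sub_add_sub_cancel]
  have hAM : 2 * s * ‖x - y‖ ≤ ‖x - y‖ ^ 2 + s ^ 2 := by
    linarith [two_mul_le_add_sq ‖x - y‖ s]
  rw [inner_smul_right, show s + s⁻¹ * inner ℝ (x - x₁) (x₁ - y) + ‖x - x₁‖ ^ 2 / (2 * s) =
    (‖x - y‖ ^ 2 + s ^ 2) / (2 * s) by rw [hsq]; field_simp; ring, le_div_iff₀ (by positivity)]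
  linarith

theorem belowPlaneAt_of_le_cappedLog {α : ℝ} (hα : 0 ≤ α) (hs : 0 < s) (hx₁ : ‖x₁ - y‖ = s)
    (hv : ∀ᶠ x in 𝓝[Dᶜ] x₁, v x ≤ -(α * s * cappedLog s s y x)) :
    BelowPlaneAt D v x₁ (s⁻¹ • (x₁ - y)) α := by
  intro ε hε
  have hquad : ∀ᶠ x in 𝓝[Dᶜ] x₁, α * (‖x - x₁‖ ^ 2 / (2 * s)) ≤ ε * ‖x - x₁‖ := by
    have hcont : ContinuousAt (fun x ↦ α * ‖x - x₁‖ / (2 * s)) x₁ := by fun_prop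
    filter_upwards [mem_nhdsWithin_of_mem_nhds
      (hcont.tendsto.eventually_le_const (u := ε) (by simpa using hε))] with x hx
    calc α * (‖x - x₁‖ ^ 2 / (2 * s)) = α * ‖x - x₁‖ / (2 * s) * ‖x - x₁‖ := by ring
      _ ≤ ε * ‖x - x₁‖ := by gcongr
  filter_upwards [hv, hquad] with x hx hxq
  set q : ℝ := max (inner ℝ (x - x₁) (s⁻¹ • (x₁ - y))) 0
  have hmax : max ‖x - y‖ s ≤ s + q + ‖x - x₁‖ ^ 2 / (2 * s) := by
    have : 0 ≤ ‖x - x₁‖ ^ 2 / (2 * s) := by positivity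
    refine max_le ?_ (by linarith [le_max_right (inner ℝ (x - x₁) (s⁻¹ • (x₁ - y))) 0])
    linarith [norm_sub_le_add_inner_add_sq (x := x) hs hx₁,
      le_max_left (inner ℝ (x - x₁) (s⁻¹ • (x₁ - y))) 0]
  have hlog : log (max ‖x - y‖ s) - log s ≤ max ‖x - y‖ s / s - 1 := by
    have hpos : 0 < max ‖x - y‖ s := lt_max_of_lt_right hs
    rw [← log_div hpos.ne' hs.ne']
    exact log_le_sub_one_of_pos (by positivity)
  calc v x ≤ α * s * (log (max ‖x - y‖ s) - log s) := by
        rw [cappedLog] at hx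
        linarith
    _ ≤ α * s * (max ‖x - y‖ s / s - 1) := by gcongr
    _ = α * (max ‖x - y‖ s - s) := by field_simp
    _ ≤ α * (q + ‖x - x₁‖ ^ 2 / (2 * s)) := by gcongr; linarith
    _ ≤ α * q + ε * ‖x - x₁‖ := by linarith

theorem IsSubsolution.continuousOn_of_disjoint (hv : IsSubsolution D f g v) (hW : Disjoint W D) :
    ContinuousOn v W :=
  hv.continuousOn.mono fun _ hx ↦ hW.notMem_of_mem_left hx

theorem IsSubsolution.viscositySubharmonicOn (hv : IsSubsolution D f g v) (hW : IsOpen W)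
    (hWD : Disjoint W D) : ViscositySubharmonicOn v W :=
  .of_nonneg hW (fun x hx ↦ hv.nonneg x (hWD.notMem_of_mem_left hx)) <|
    hv.subharmonic.mono fun _ hx ↦ ⟨⟨hWD.notMem_of_mem_left hx.1, hx.2⟩,
      (hWD.closure_right hW).notMem_of_mem_left hx.1⟩

theorem IsSubsolution.eq_zero_of_disjoint (hv : IsSubsolution D f g v) (hs : s ≠ 0)
    (hD : Disjoint (closedBall y s) D) (hy : Disjoint (ball y s) (posSet D v)) :
    Set.EqOn v 0 (closedBall y s) := by
  have hball : Set.EqOn v 0 (ball y s) := fun x hx ↦ by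
    have hxD : x ∉ D := hD.notMem_of_mem_left (ball_subset_closedBall hx)
    exact le_antisymm (not_lt.1 fun h ↦ hy.notMem_of_mem_left hx ⟨hxD, h⟩) (hv.nonneg x hxD)
  exact hball.of_subset_closure (hv.continuousOn_of_disjoint hD) continuousOn_const
    ball_subset_closedBall (closure_ball y hs).ge

theorem IsSubsolution.exists_lt_of_tangent (hv : IsSubsolution D f g v) (hlam : 0 < lam)
    (hf : lam ≤ f x₁) (hx₁ : x₁ ∈ frontier (posSet D v))
    (htan : IsExteriorTangentBall (posSet D v) x₁ y s) (hD : Disjoint (closedBall y (2 * s)) D) :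
    ∃ x ∈ closedBall y (2 * s), √lam * log 2 / 2 * s < v x := by
  by_contra! hle
  obtain ⟨hs, hdis, hdist⟩ := id htan
  have hzero := hv.eq_zero_of_disjoint hs.ne'
    (hD.mono_left (closedBall_subset_closedBall (by linarith))) hdis
  have hlog : log (2 * s) = log 2 + log s := log_mul two_ne_zero hs.ne'
  have hcap : ∀ x ∈ closedBall y (2 * s),
      v x + √lam / 2 * s * cappedLog (2 * s) s y x ≤ √lam / 2 * s * log 2 :=
    ViscositySubharmonicOn.add_cappedLog_le hs (hv.continuousOn_of_disjoint hD)
      (hv.viscositySubharmonicOn isOpen_ball (hD.mono_left ball_subset_closedBall))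
      (fun x hx ↦ (hzero hx).le)
      (HarmonicContOnCl.mk_ball (harmonicOnNhd_const _) continuousOn_const)
      (fun x hx ↦ (hle x (sphere_subset_closedBall hx)).trans_eq (by ring))
      (fun x _ ↦ by rw [hlog, add_sub_cancel_right])
  have hbelow : BelowPlaneAt D v x₁ (s⁻¹ • (x₁ - y)) (√lam / 2) := by
    refine belowPlaneAt_of_le_cappedLog (by positivity) hs (by rwa [← dist_eq_norm]) ?_
    have hx₁y : x₁ ∈ ball y (2 * s) := by
      rw [mem_ball, hdist]
      linarith
    filter_upwards [mem_nhdsWithin_of_mem_nhds (isOpen_ball.mem_nhds hx₁y)] with x hx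
    have := hcap x (ball_subset_closedBall hx)
    rw [cappedLog, hlog] at this
    rw [cappedLog]
    linarith
  have hfbc : √(f x₁) ≤ √lam / 2 := hv.fbc x₁ hx₁ y s htan _ hbelow
  linarith [sqrt_le_sqrt hf, sqrt_pos.2 hlam]

theorem isClosed_setOf_disjoint_ball (W : Set Plane) (s : ℝ) :
    IsClosed {y | Disjoint (ball y s) W} := by
  have : {y | Disjoint (ball y s) W} = ⋂ w ∈ W, {y | s ≤ dist w y} := by
    ext y
    simp only [Set.disjoint_right, mem_ball, not_lt, Set.mem_iInter, Set.mem_ofPred_eq]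
  rw [this]
  exact isClosed_biInter fun w _ ↦ isClosed_le continuous_const (by fun_prop)

theorem eventually_disjoint_ball_of_disjoint_closedBall (hs : 0 ≤ s)
    (h : Disjoint (closedBall y s) W) (hW : IsClosed W) :
    ∀ᶠ z in 𝓝 y, Disjoint (ball z s) W := by
  obtain ⟨δ, hδ, hdis⟩ := h.exists_thickenings (isCompact_closedBall _ _) hW
  filter_upwards [ball_mem_nhds y hδ] with z hz
  refine hdis.mono (fun x hx ↦ ?_) (self_subset_thickening hδ _)
  rw [thickening_closedBall hδ hs, mem_ball]
  calc dist x y ≤ dist x z + dist z y := dist_triangle _ _ _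
    _ < δ + s := by
      rw [add_comm]
      exact add_lt_add hz hx

theorem IsSubsolution.disjoint_ball_of_isPreconnected (hv : IsSubsolution D f g v) (hlam : 0 < lam)
    (hf : ∀ x, lam ≤ f x) {C : Set Plane} (hC : IsPreconnected C) (hs : 0 < s)
    (hD : ∀ y ∈ C, Disjoint (closedBall y (2 * s)) D)
    (hle : ∀ y ∈ C, ∀ x ∈ closedBall y (2 * s), v x ≤ √lam * log 2 / 2 * s) (hy : y ∈ C)
    (hdis : Disjoint (ball y s) (posSet D v)) (hz : z ∈ C) : Disjoint (ball z s) (posSet D v) := by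
  have hopen : ∀ w ∈ C, Disjoint (ball w s) (posSet D v) →
      ∀ᶠ w' in 𝓝 w, Disjoint (ball w' s) (posSet D v) := by
    intro w hw hdisw
    have hsep : Disjoint (closedBall w s) (closure (posSet D v)) := by
      -- A common point would be a point of tangency, and `v` is large next to those.
      refine Set.disjoint_left.2 fun x₁ hx₁ hx₁' ↦ ?_
      obtain ⟨hfr, hdist⟩ := mem_frontier_of_disjoint_ball hs hdisw hx₁ hx₁'
      obtain ⟨x, hx, hlt⟩ := hv.exists_lt_of_tangent hlam (hf x₁) hfr ⟨hs, hdisw, hdist⟩ (hD w hw)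
      exact (hle w hw x hx).not_gt hlt
    exact (eventually_disjoint_ball_of_disjoint_closedBall hs.le hsep isClosed_closure).mono
      fun w' h ↦ h.mono_right subset_closure
  refine (?_ : C ⊆ {w | Disjoint (ball w s) (posSet D v)}) hz
  refine (hC.subset_of_closure_inter_subset isOpen_interior
    ⟨y, hy, mem_interior_iff_mem_nhds.2 (hopen y hy hdis)⟩ fun w hw ↦
      mem_interior_iff_mem_nhds.2 (hopen w hw.2 ?_)).trans interior_subset
  exact closure_minimal interior_subset (isClosed_setOf_disjoint_ball _ s) hw.1

end ExteriorTangentBall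

section CircleInClosure

variable {D W : Set Plane} {f g v Φ : Plane → ℝ} {lam r s R θ : ℝ} {c x₀ x₁ y z : Plane}

theorem nonneg_of_nonneg_sphere (hΦ : HarmonicContOnCl Φ (ball c R))
    (h₀ : ∀ x ∈ sphere c R, 0 ≤ Φ x) : ∀ x ∈ closedBall c R, 0 ≤ Φ x :=
  (viscositySubharmonicOn_of_harmonicOnNhd (harmonicOnNhd_const 0)).le_harmonic_of_le_sphere
    continuousOn_const hΦ h₀

theorem harnack_closedBall (hΦ : HarmonicContOnCl Φ (ball c R)) (h₀ : ∀ x ∈ sphere c R, 0 ≤ Φ x)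
    (hR : 0 < R) (hθ : θ < 1) (hz : z ∈ closedBall c (θ * R)) :
    (1 - θ) / (1 + θ) * Φ c ≤ Φ z ∧ Φ z ≤ (1 + θ) / (1 - θ) * Φ c := by
  have hc : 0 ≤ Φ c := nonneg_of_nonneg_sphere hΦ h₀ c (mem_closedBall_self hR.le)
  rw [mem_closedBall, dist_eq_norm] at hz
  have hzR : ‖z - c‖ < R := hz.trans_lt (mul_lt_of_lt_one_left hR hθ)
  have hθ₀ : 0 ≤ θ := nonneg_of_mul_nonneg_left ((norm_nonneg _).trans hz) hR
  obtain ⟨hlow, hupp⟩ := harnack hΦ h₀ (w := z) (by rwa [mem_ball, dist_eq_norm])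
  refine ⟨hlow.trans' ?_, hupp.trans ?_⟩
  · gcongr ?_ * _
    rw [div_le_div_iff₀ (by positivity) (by positivity)]
    linarith
  · gcongr ?_ * _
    rw [div_le_div_iff₀ (by linarith) (by linarith)]
    linarith

theorem IsSubsolution.absorbsPotential (hv : IsSubsolution D f g v) (hlam : 0 < lam)
    (hf : lam ≤ f x₁) (hx₁ : x₁ ∈ frontier (posSet D v))
    (htan : IsExteriorTangentBall (posSet D v) x₁ y s) (hD : Disjoint (closedBall y (4 * s)) D) :
    AbsorbsPotential v (√lam / 20 * s) s (4 * s) y := by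
  have hs : 0 < s := htan.1
  have hcont := hv.continuousOn_of_disjoint hD
  have hsub := hv.viscositySubharmonicOn isOpen_ball (hD.mono_left ball_subset_closedBall)
  obtain ⟨H, hH, hHv⟩ :=
    exists_harmonicContOnCl_eqOn_sphere (hcont.mono sphere_subset_closedBall)
  have hvH : ∀ x ∈ closedBall y (4 * s), v x ≤ H x :=
    hsub.le_harmonic_of_le_sphere hcont hH fun x hx ↦ (hHv hx).ge
  have hH₀ : ∀ x ∈ sphere y (4 * s), 0 ≤ H x := fun x hx ↦ by
    rw [hHv hx]
    exact hv.nonneg x (hD.notMem_of_mem_left (sphere_subset_closedBall hx))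
  have hcenter : √lam * log 2 / 6 * s ≤ H y := by
    obtain ⟨x₂, hx₂, hlt⟩ := hv.exists_lt_of_tangent hlam hf hx₁ htan
      (hD.mono_left (closedBall_subset_closedBall (by linarith)))
    have hharnack := (harnack_closedBall hH hH₀ (θ := 1 / 2) (by linarith) (by norm_num)
      (z := x₂) (by convert hx₂ using 2; ring)).2
    norm_num at hharnack
    linarith [hvH x₂ (closedBall_subset_closedBall (by linarith) hx₂)]
  have hlog : log (4 * s) - log s = 2 * log 2 := by
    rw [log_mul four_ne_zero hs.ne', show (4 : ℝ) = 2 ^ 2 by norm_num, log_pow]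
    push_cast
    ring
  refine ⟨H, hH.continuousOn_ball, viscositySubharmonicOn_of_harmonicOnNhd hH.harmonicOnNhd, hHv,
    hsub.add_cappedLog_le hs hcont (fun x hx ↦ ?_) hH (fun x hx ↦ (hHv hx).ge) fun x hx ↦ ?_⟩
  · exact (hv.eq_zero_of_disjoint hs.ne'
      (hD.mono_left (closedBall_subset_closedBall (by linarith))) htan.2.1 hx).le
  · have hharnack := (harnack_closedBall hH hH₀ (θ := 1 / 4) (by linarith) (by norm_num)
      (z := x) (by convert hx using 2; ring)).1
    norm_num at hharnack
    rw [hlog]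
    linarith

theorem exists_isExteriorTangentBall (hW : W.Nonempty) (hy : y ∉ closure W) :
    ∃ s x, x ∈ frontier W ∧ IsExteriorTangentBall W x y s := by
  obtain ⟨x, hx, hxd⟩ := isClosed_closure.exists_infDist_eq_dist hW.closure y
  have hpos : 0 < dist x y := dist_pos.2 fun h ↦ hy (h ▸ hx)
  have hdis : Disjoint (ball y (dist x y)) W := by
    rw [dist_comm, ← hxd, infDist_closure]
    exact disjoint_ball_infDist
  exact ⟨dist x y, x, (mem_frontier_of_disjoint_ball hpos hdis (mem_closedBall.2 le_rfl) hx).1,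
    hpos, hdis, rfl⟩

theorem exists_finset_lt_sum_of_lt_tsum_ofReal {ι : Type*} {φ : ι → ℝ} (hφ : ∀ i, 0 ≤ φ i) {b : ℝ}
    (h : ENNReal.ofReal b < ∑' i, ENNReal.ofReal (φ i)) : ∃ J : Finset ι, b < ∑ i ∈ J, φ i := by
  rw [ENNReal.tsum_eq_iSup_sum, lt_iSup_iff] at h
  obtain ⟨J, hJ⟩ := h
  rw [← ENNReal.ofReal_sum_of_nonneg fun i _ ↦ hφ i] at hJ
  exact ⟨J, (ENNReal.ofReal_lt_ofReal_iff'.1 hJ).1⟩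

theorem exists_finset_pairwiseDisjoint_closedBall {a b S : ℝ} (hab : a < b) {R : ℝ → ℝ}
    (hR : ∀ t ∈ Set.Icc a b, 0 < R t) (hS : ∀ t ∈ Set.Icc a b, R t ≤ S) :
    ∃ J : Finset ℝ, (J : Set ℝ) ⊆ Set.Icc a b ∧
      ((J : Set ℝ).PairwiseDisjoint fun t ↦ closedBall t (R t)) ∧
      (b - a) / 2 < ∑ t ∈ J, 10 * R t := by
  obtain ⟨u, hu, hdisj, hcov⟩ := Vitali.exists_disjoint_subfamily_covering_enlargement_closedBall
    (Set.Icc a b) id R S hS 5 (by norm_num)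
  have hcount : u.Countable := hdisj.countable_of_nonempty_interior fun t ht ↦ by
    have hRt := hR t (hu ht)
    rw [interior_closedBall _ hRt.ne']
    exact ⟨t, mem_ball_self hRt⟩
  have hcover : Set.Icc a b ⊆ ⋃ t ∈ u, closedBall t (5 * R t) := fun t ht ↦ by
    obtain ⟨t', ht', hsub⟩ := hcov t ht
    exact Set.mem_biUnion ht' (hsub (mem_closedBall_self (hR t ht).le))
  have hvol : ENNReal.ofReal ((b - a) / 2) < ∑' t : u, ENNReal.ofReal (10 * R t) :=
    calc ENNReal.ofReal ((b - a) / 2) < ENNReal.ofReal (b - a) :=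
        (ENNReal.ofReal_lt_ofReal_iff (by linarith)).2 (by linarith)
      _ = MeasureTheory.volume (Set.Icc a b) := volume_Icc.symm
      _ ≤ MeasureTheory.volume (⋃ t ∈ u, closedBall t (5 * R t)) :=
        MeasureTheory.measure_mono hcover
      _ ≤ ∑' t : u, MeasureTheory.volume (closedBall (t : ℝ) (5 * R t)) :=
        MeasureTheory.measure_biUnion_le _ hcount _
      _ = ∑' t : u, ENNReal.ofReal (10 * R t) := tsum_congr fun t ↦ by
        rw [Real.volume_closedBall]
        ring_nf
  obtain ⟨J, hJ⟩ := exists_finset_lt_sum_of_lt_tsum_ofReal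
    (fun t : u ↦ by linarith [hR t (hu t.2)]) hvol
  have hsub : ((J.map (.subtype _) : Finset ℝ) : Set ℝ) ⊆ u := by simp
  exact ⟨_, hsub.trans hu, hdisj.subset hsub, hJ.trans_eq (by simp)⟩

theorem disjoint_closedBall_of_disjoint_closedBall_dist {X : Type*} [PseudoMetricSpace X]
    {y y' : X} {R R' : ℝ} (x₀ : X)
    (h : Disjoint (closedBall (dist y x₀) R) (closedBall (dist y' x₀) R')) :
    Disjoint (closedBall y R) (closedBall y' R') :=
  (h.preimage (dist · x₀)).mono (fun x hx ↦ (dist_dist_dist_le_left x y x₀).trans hx)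
    fun x hx ↦ (dist_dist_dist_le_left x y' x₀).trans hx

theorem IsSubsolution.sum_radius_le {ι : Type*} {J : Finset ι} {y : ι → Plane} {s : ι → ℝ} {M : ℝ}
    (hv : IsSubsolution D f g v) (hlam : 0 < lam) (hf : ∀ x, lam ≤ f x) (hr : 0 < r)
    (hD : Disjoint (ball x₀ r) D) (hM : ∀ x ∈ ball x₀ r, v x ≤ M)
    (hy : ∀ i ∈ J, dist (y i) x₀ ≤ r / 4) (hsr : ∀ i ∈ J, s i ≤ r / 16)
    (hdisj : (J : Set ι).PairwiseDisjoint fun i ↦ closedBall (y i) (4 * s i))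
    (htan : ∀ i ∈ J, ∃ x ∈ frontier (posSet D v),
      IsExteriorTangentBall (posSet D v) x (y i) (s i)) :
    ∑ i ∈ J, √lam / 20 * s i * log 2 ≤ M := by
  have hs : ∀ i ∈ J, 0 < s i := fun i hi ↦
    let ⟨_, _, hpos, _⟩ := htan i hi
    hpos
  have hball : ∀ i ∈ J, closedBall (y i) (4 * s i) ⊆ ball x₀ (3 * r / 4) := fun i hi ↦
    closedBall_subset_ball' (by linarith [hy i hi, hsr i hi])
  have hbig : closedBall x₀ (3 * r / 4) ⊆ ball x₀ r := closedBall_subset_ball (by linarith)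
  have hDbig := hD.mono_left hbig
  have habs : ∀ i ∈ J, AbsorbsPotential v (√lam / 20 * s i) (s i) (4 * s i) (y i) := fun i hi ↦ by
    obtain ⟨x, hx, hxy⟩ := htan i hi
    exact hv.absorbsPotential hlam (hf x) hx hxy
      (hDbig.mono_left ((hball i hi).trans ball_subset_closedBall))
  have hpot : v x₀ + ∑ i ∈ J, √lam / 20 * s i * cappedLog (r / 2) (s i) (y i) x₀ ≤ M := by
    refine ViscositySubharmonicOn.add_sum_cappedLog_le hs (fun i hi ↦ by linarith [hs i hi]) hdisj
      (fun i hi ↦ ball_subset_closedBall.trans (hball i hi)) (hv.continuousOn_of_disjoint hDbig)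
      (hv.viscositySubharmonicOn isOpen_ball (hDbig.mono_left ball_subset_closedBall)) habs
      (fun x hx ↦ ?_) x₀ (mem_closedBall_self (by positivity))
    refine add_le_of_le_of_nonpos (hM x (hbig (sphere_subset_closedBall hx)))
      (Finset.sum_nonpos fun i hi ↦ ?_)
    have hsi := hs i hi
    refine mul_nonpos_of_nonneg_of_nonpos (by positivity) (cappedLog_nonpos (by positivity) ?_)
    rw [mem_sphere] at hx
    rw [← dist_eq_norm]
    linarith [dist_triangle x (y i) x₀, hy i hi]
  refine le_trans (Finset.sum_le_sum fun i hi ↦ ?_) ((le_add_of_nonneg_left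
    (hv.nonneg x₀ (hD.notMem_of_mem_left (mem_ball_self hr)))).trans hpot)
  have hsi := hs i hi
  have hyi := hy i hi
  rw [dist_comm, dist_eq_norm] at hyi
  gcongr
  exact log_le_cappedLog two_pos hsi (by linarith [hsr i hi]) (by linarith)

theorem IsSubsolution.exists_sphere_subset_closure (hv : IsSubsolution D f g v) (hlam : 0 < lam)
    (hf : ∀ x, lam ≤ f x) (hr : 0 < r) (hD : Disjoint (ball x₀ r) D)
    (hle : ∀ x ∈ ball x₀ r, v x ≤ √lam * log 2 / 12800 * r)
    (hfat : ∀ y ∈ closedBall x₀ (r / 2), ¬ Disjoint (ball y (r / 16)) (posSet D v)) :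
    ∃ t ∈ Set.Icc (r / 8) (r / 4), sphere x₀ t ⊆ closure (posSet D v) := by
  by_contra! hcon
  have hne : (posSet D v).Nonempty :=
    (Set.not_disjoint_iff_nonempty_inter.1 (hfat x₀ (mem_closedBall_self (by positivity)))).mono
      Set.inter_subset_right
  have hex : ∀ t ∈ Set.Icc (r / 8) (r / 4), ∃ y s, dist y x₀ = t ∧ s ≤ r / 16 ∧
      ∃ x ∈ frontier (posSet D v), IsExteriorTangentBall (posSet D v) x y s := fun t ht ↦ by
    obtain ⟨y, hy, hycl⟩ := Set.not_subset.1 (hcon t ht)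
    obtain ⟨s, x, hx, htan⟩ := exists_isExteriorTangentBall hne hycl
    refine ⟨y, s, hy, le_of_not_gt fun h ↦ ?_, x, hx, htan⟩
    exact hfat y (mem_closedBall.2 (by rw [mem_sphere.1 hy]; linarith [ht.2]))
      (htan.2.1.mono_left (ball_subset_ball h.le))
  choose! y s hy hsr htan using hex
  obtain ⟨J, hJ, hdisj, hsum⟩ := exists_finset_pairwiseDisjoint_closedBall
    (a := r / 8) (b := r / 4) (R := fun t ↦ 4 * s t) (S := r / 4) (by linarith)
    (fun t ht ↦ by
      obtain ⟨_, -, hpos, -⟩ := htan t ht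
      linarith)
    (fun t ht ↦ by linarith [hsr t ht])
  have hupper : ∑ t ∈ J, √lam / 20 * s t * log 2 ≤ √lam * log 2 / 12800 * r :=
    hv.sum_radius_le hlam hf hr hD hle (fun t ht ↦ (hy t (hJ ht)).trans_le (hJ ht).2)
      (fun t ht ↦ hsr t (hJ ht))
      (fun i hi j hj hij ↦ disjoint_closedBall_of_disjoint_closedBall_dist x₀ (by
        rw [hy i (hJ hi), hy j (hJ hj)]
        exact hdisj hi hj hij))
      (fun t ht ↦ htan t (hJ ht))
  refine hupper.not_gt ?_
  calc √lam * log 2 / 12800 * r = √lam * log 2 / 800 * ((r / 4 - r / 8) / 2) := by ring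
    _ < √lam * log 2 / 800 * ∑ t ∈ J, 10 * (4 * s t) := by gcongr
    _ = ∑ t ∈ J, √lam / 20 * s t * log 2 := by
      rw [Finset.mul_sum]
      exact Finset.sum_congr rfl fun t _ ↦ by ring

end CircleInClosure

section HarmonicReplacement

variable {C D : Set Plane} {f g h v H : Plane → ℝ} {t : ℝ} {x₀ z : Plane}

theorem pos_of_nonneg_sphere_of_pos (hH : HarmonicContOnCl H (ball x₀ t))
    (h₀ : ∀ x ∈ sphere x₀ t, 0 ≤ H x) (hz : z ∈ ball x₀ t) (hHz : 0 < H z) :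
    ∀ x ∈ ball x₀ t, 0 < H x := fun x hx ↦ by
  have hlow := (harnack hH h₀ hx).1
  have hupp := (harnack hH h₀ hz).2
  rw [mem_ball, dist_eq_norm] at hx hz
  have hcenter : 0 < H x₀ :=
    pos_of_mul_pos_right (hHz.trans_le hupp) (div_nonneg (by linarith [norm_nonneg (z - x₀)])
      (by linarith))
  exact hlow.trans_lt' (mul_pos (div_pos (by linarith) (by linarith [norm_nonneg (x - x₀)]))
    hcenter)

open Classical in
theorem posSet_piecewise_ball (hD : Disjoint (ball x₀ t) D) (hH : ∀ x ∈ ball x₀ t, 0 < H x) :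
    posSet D ((ball x₀ t).piecewise H v) = posSet D v ∪ ball x₀ t := by
  ext x
  by_cases hx : x ∈ ball x₀ t
  · simp [posSet, hx, hH x hx, hD.notMem_of_mem_left hx]
  · simp [posSet, hx]

open Classical in
theorem IsSubsolution.piecewise_ball (hv : IsSubsolution D f g v)
    (hD : Disjoint (closedBall x₀ t) D) (hsph : sphere x₀ t ⊆ closure (posSet D v))
    (hH : HarmonicContOnCl H (ball x₀ t)) (hHv : Set.EqOn H v (sphere x₀ t))
    (hpos : ∀ x ∈ ball x₀ t, 0 < H x) :
    IsSubsolution D f g ((ball x₀ t).piecewise H v) := by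
  have hDb : Disjoint (ball x₀ t) D := hD.mono_left ball_subset_closedBall
  have hDc : Disjoint (ball x₀ t) (closure D) := hDb.closure_right isOpen_ball
  have hvH : ∀ x ∈ ball x₀ t, v x ≤ H x := fun x hx ↦
    (hv.viscositySubharmonicOn isOpen_ball hDb).le_harmonic_of_le_sphere
      (hv.continuousOn_of_disjoint hD) hH (fun z hz ↦ (hHv hz).ge) x (ball_subset_closedBall hx)
  have hle : ∀ x, v x ≤ (ball x₀ t).piecewise H v x := fun x ↦
    Set.le_piecewise (g := v) hvH (fun _ _ ↦ le_rfl) x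
  refine ⟨continuousOn_piecewise_ball hH.continuousOn_ball hv.continuousOn hHv,
    fun x hx ↦ (hv.nonneg x hx).trans (hle x), ?_, fun x hx ↦ ?_,
    fun x₁ hx₁ y s htan α hα ↦ ?_⟩
  · have hU : Disjoint (closure D)ᶜ D := disjoint_compl_left.mono_right subset_closure
    exact (((hv.viscositySubharmonicOn isClosed_closure.isOpen_compl hU).mono
      Set.sdiff_subset).piecewise ((viscositySubharmonicOn_of_harmonicOnNhd hH.harmonicOnNhd).mono
      Set.inter_subset_right) isClosed_closure.isOpen_compl isOpen_ball
      fun x hx ↦ hvH x hx.2).mono fun x hx ↦ hx.2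
  · rw [Set.piecewise_eq_of_notMem _ _ _ (hDc.notMem_of_mem_right (frontier_subset_closure hx))]
    exact hv.le_boundary x hx
  · rw [posSet_piecewise_ball hDb hpos] at hx₁ htan
    have hx₁b : x₁ ∉ ball x₀ t := fun hx ↦
      hx₁.2 (interior_maximal Set.subset_union_right isOpen_ball hx)
    have hcl : x₁ ∈ closure (posSet D v) := by
      rcases closure_union.subset hx₁.1 with hx | hx
      · exact hx
      · refine hsph ?_
        rw [← closedBall_sdiff_ball]
        exact ⟨closure_ball_subset_closedBall hx, hx₁b⟩
    exact hv.fbc x₁ ⟨hcl, fun hx ↦ hx₁.2 (interior_mono Set.subset_union_left hx)⟩ y s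
      ⟨htan.1, htan.2.1.mono_right Set.subset_union_left, htan.2.2⟩ α fun ε hε ↦
        (hα ε hε).mono fun x hx ↦ (hle x).trans hx

theorem IsSubsolution.exists_pos_on_ball (hv : IsSubsolution D f g v) (hC : Convex ℝ C)
    (hCc : IsClosed C) (hh : ContinuousOn h Dᶜ) (hΩ : posSet D h ⊆ C)
    (hsuper : ViscositySubharmonicOn (-h) (interior C \ closure D)) (hvh : ∀ x ∉ D, v x ≤ h x)
    (hD : Disjoint (closedBall x₀ t) D) (hsph : sphere x₀ t ⊆ closure (posSet D v))
    (hz : z ∈ ball x₀ t) (hvz : 0 < v z) :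
    ∃ w, IsSubsolution D f g w ∧ (∀ x ∉ D, w x ≤ h x) ∧ ∀ x ∈ ball x₀ t, 0 < w x := by
  classical
  have hDb : Disjoint (ball x₀ t) D := hD.mono_left ball_subset_closedBall
  have hcont := hv.continuousOn_of_disjoint hD
  obtain ⟨H, hH, hHv⟩ :=
    exists_harmonicContOnCl_eqOn_sphere (hcont.mono sphere_subset_closedBall)
  have hvH : v z ≤ H z := (hv.viscositySubharmonicOn isOpen_ball hDb).le_harmonic_of_le_sphere
    hcont hH (fun x hx ↦ (hHv hx).ge) z (ball_subset_closedBall hz)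
  have hpos : ∀ x ∈ ball x₀ t, 0 < H x :=
    pos_of_nonneg_sphere_of_pos hH (fun x hx ↦ by
      rw [hHv hx]
      exact hv.nonneg x (hD.notMem_of_mem_left (sphere_subset_closedBall hx))) hz
      (hvz.trans_le hvH)
  have hballC : closedBall x₀ t ⊆ C := by
    rw [← convexHull_sphere_eq_closedBall x₀ (pos_of_mem_ball hz).le]
    refine convexHull_min (hsph.trans (closure_minimal (fun x hx ↦ ?_) hCc)) hC
    exact hΩ ⟨hx.1, hx.2.trans_le (hvh x hx.1)⟩
  have hsub : ViscositySubharmonicOn (-h + H) (ball x₀ t) :=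
    (hsuper.mono fun x hx ↦ ⟨interior_maximal (ball_subset_closedBall.trans hballC) isOpen_ball hx,
      (hDb.closure_right isOpen_ball).notMem_of_mem_left hx⟩).add_harmonicOnNhd hH.harmonicOnNhd
  have hHh : ∀ x ∈ closedBall x₀ t, (-h + H) x ≤ 0 :=
    hsub.le_of_le_sphere ((hh.mono fun x hx ↦ hD.notMem_of_mem_left hx).neg.add
      hH.continuousOn_ball) fun x hx ↦ by
        have := hvh x (hD.notMem_of_mem_left (sphere_subset_closedBall hx))
        simpa [hHv hx] using this
  refine ⟨_, hv.piecewise_ball hD hsph hH hHv hpos, fun x hx ↦ ?_, fun x hx ↦ ?_⟩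
  · by_cases hxb : x ∈ ball x₀ t
    · simpa [hxb] using hHh x (ball_subset_closedBall hxb)
    · simpa [hxb] using hvh x hx
  · simpa [hx] using hpos x hx

end HarmonicReplacement

section Nondegeneracy

variable {C D : Set Plane} {f g h v : Plane → ℝ} {lam r : ℝ} {x₀ x z : Plane}

theorem IsSubsolution.not_disjoint_ball (hv : IsSubsolution D f g v) (hlam : 0 < lam)
    (hf : ∀ x, lam ≤ f x) (hD : Disjoint (ball x₀ r) D)
    (hle : ∀ x ∈ ball x₀ r, v x ≤ √lam * log 2 / 32 * r) (hz : z ∈ ball x₀ (r / 16))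
    (hvz : 0 < v z) : ∀ y ∈ closedBall x₀ (r / 2), ¬ Disjoint (ball y (r / 16)) (posSet D v) := by
  intro y hy hdis
  have hr : 0 < r / 16 := pos_of_mem_ball hz
  have hsub : ∀ y ∈ closedBall x₀ (r / 2), closedBall y (2 * (r / 16)) ⊆ ball x₀ r := fun y hy ↦
    closedBall_subset_ball' (by rw [mem_closedBall] at hy; linarith)
  have hdis₀ := hv.disjoint_ball_of_isPreconnected hlam hf
    (convex_closedBall x₀ (r / 2)).isPreconnected hr (fun y hy ↦ hD.mono_left (hsub y hy))
    (fun y hy x hx ↦ (hle x (hsub y hy hx)).trans_eq (by ring)) hy hdis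
    (mem_closedBall_self (by linarith))
  exact hdis₀.notMem_of_mem_left hz
    ⟨hD.notMem_of_mem_left (ball_subset_ball (by linarith) hz), hvz⟩

theorem IsSubsolution.le_largestSubsolution (hv : IsSubsolution D f g v)
    (hvh : ∀ x ∉ D, v x ≤ h x) (hx : x ∉ D) : v x ≤ largestSubsolution D f g h x := by
  refine le_csSup ⟨h x, ?_⟩ ⟨v, hv, hvh, rfl⟩
  rintro _ ⟨v', -, hv', rfl⟩
  exact hv' x hx

theorem largestSubsolution_le (hx : x ∉ D) : largestSubsolution D f g h x ≤ max (h x) 0 := by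
  refine Real.sSup_le ?_ (le_max_right _ _)
  rintro _ ⟨v, -, hvh, rfl⟩
  exact (hvh x hx).trans (le_max_left _ _)

theorem exists_isSubsolution_of_pos (hx : 0 < largestSubsolution D f g h x) :
    ∃ v, IsSubsolution D f g v ∧ (∀ z ∉ D, v z ≤ h z) ∧ 0 < v x := by
  contrapose! hx
  refine Real.sSup_nonpos ?_
  rintro _ ⟨v, hv, hvh, rfl⟩
  exact hx v hv hvh

theorem bddAbove_largestSubsolution_ball (hDo : IsOpen D) (hh : ContinuousOn h Dᶜ)
    (hD : Disjoint (ball x₀ r) D) : BddAbove (largestSubsolution D f g h '' ball x₀ r) := by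
  have hDcl : closure (ball x₀ r) ⊆ Dᶜ := fun x hx ↦
    (hD.closure_left hDo).notMem_of_mem_left hx
  have hcpt : IsCompact (closure (ball x₀ r)) := isBounded_ball.isCompact_closure
  obtain ⟨M, hM⟩ := hcpt.bddAbove_image ((hh.mono hDcl).sup continuousOn_const (g := fun _ ↦ 0))
  refine ⟨M, ?_⟩
  rintro _ ⟨x, hx, rfl⟩
  exact (largestSubsolution_le (hD.notMem_of_mem_left hx)).trans
    (hM ⟨x, subset_closure hx, rfl⟩)

theorem theorem3p5_general (hlam : 0 < lam) (hDo : IsOpen D) (hf : ∀ x, lam ≤ f x)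
    (hC : Convex ℝ C) (hCc : IsClosed C) (hh : ContinuousOn h Dᶜ) (hΩ : posSet D h ⊆ C)
    (hsuper : ViscositySubharmonicOn (-h) (interior C \ closure D))
    (hx₀ : x₀ ∈ frontier (posSet D (largestSubsolution D f g h))) (hr : 0 < r)
    (hD : Disjoint (ball x₀ r) D) :
    √lam * log 2 / 12800 * r ≤ sSup (largestSubsolution D f g h '' ball x₀ r) := by
  by_contra! hlt
  obtain ⟨z, hzΩ, hz⟩ := Metric.mem_closure_iff.1 hx₀.1 (r / 16) (by positivity)
  rw [dist_comm, ← mem_ball] at hz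
  obtain ⟨v, hv, hvh, hvz⟩ := exists_isSubsolution_of_pos hzΩ.2
  have hle : ∀ x ∈ ball x₀ r, v x ≤ √lam * log 2 / 12800 * r := fun x hx ↦
    ((hv.le_largestSubsolution hvh (hD.notMem_of_mem_left hx)).trans
      (le_csSup (bddAbove_largestSubsolution_ball hDo hh hD) ⟨x, hx, rfl⟩)).trans hlt.le
  have hfat := hv.not_disjoint_ball hlam hf hD
    (fun x hx ↦ (hle x hx).trans (by gcongr; norm_num)) hz hvz
  obtain ⟨t, ht, hsph⟩ := hv.exists_sphere_subset_closure hlam hf hr hD hle hfat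
  obtain ⟨w, hw, hwh, hwpos⟩ := hv.exists_pos_on_ball hC hCc hh hΩ hsuper hvh
    (hD.mono_left (closedBall_subset_ball (by linarith [ht.2]))) hsph
    (ball_subset_ball (by linarith [ht.1]) hz) hvz
  refine hx₀.2 (interior_maximal (fun x hx ↦ ?_) isOpen_ball
    (mem_ball_self (by linarith [ht.1] : 0 < t)))
  have hxD : x ∉ D := hD.notMem_of_mem_left (ball_subset_ball (by linarith [ht.2]) hx)
  exact ⟨hxD, (hwpos x hx).trans_le (hw.le_largestSubsolution hwh hxD)⟩

end Nondegeneracy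

section Barrier

variable {D : Set Plane} {lam ρ m : ℝ} {p : Plane}

theorem barrierRadius_nonneg (hρ : 0 ≤ ρ) : 0 ≤ barrierRadius lam ρ m :=
  Real.sInf_nonneg fun _ hR ↦ hρ.trans hR.1.le

theorem log_div_barrierRadius_nonpos (hρ : 0 ≤ ρ) : log (ρ / barrierRadius lam ρ m) ≤ 0 := by
  refine log_nonpos (div_nonneg hρ (barrierRadius_nonneg hρ)) ?_
  rcases Set.eq_empty_or_nonempty {R : ℝ | ρ < R ∧ m ^ 2 / (R ^ 2 * log (ρ / R) ^ 2) < lam}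
    with h | h
  · simp [barrierRadius, h]
  · exact div_le_one_of_le₀ (le_csInf h fun _ hR ↦ hR.1.le) (barrierRadius_nonneg hρ)

theorem barrier_coeff_nonpos (hρ : 0 ≤ ρ) (hm : 0 ≤ m) :
    m / log (ρ / barrierRadius lam ρ m) ≤ 0 :=
  div_nonpos_of_nonneg_of_nonpos hm (log_div_barrierRadius_nonpos hρ)

theorem posSet_barrier_subset (hρ : 0 ≤ ρ) (hm : 0 ≤ m) :
    posSet D (barrier lam p ρ m) ⊆ closedBall p (barrierRadius lam ρ m) := by
  rintro x ⟨-, hpos⟩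
  by_contra hx
  rw [mem_closedBall, dist_eq_norm, not_le] at hx
  refine hpos.not_ge (max_le ?_ le_rfl)
  refine mul_nonpos_of_nonpos_of_nonneg (barrier_coeff_nonpos hρ hm) ?_
  rcases (barrierRadius_nonneg (lam := lam) (m := m) hρ).eq_or_lt with h | h
  · simp [← h]
  · exact log_nonneg ((one_le_div h).2 hx.le)

theorem continuousOn_barrier (hp : p ∈ D) : ContinuousOn (barrier lam p ρ m) Dᶜ := by
  by_cases h : barrierRadius lam ρ m = 0
  · have hzero : barrier lam p ρ m = fun _ ↦ 0 := funext fun x ↦ by simp [barrier, h]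
    rw [hzero]
    exact continuousOn_const
  · refine ContinuousOn.sup (continuousOn_const.mul (ContinuousOn.log (by fun_prop) fun x hx ↦ ?_))
      continuousOn_const
    exact div_ne_zero (norm_ne_zero_iff.2 (sub_ne_zero.2 fun h ↦ hx (h ▸ hp))) h

theorem harmonicOnNhd_barrier (hρ : 0 ≤ ρ) (hm : 0 ≤ m) :
    HarmonicOnNhd (barrier lam p ρ m) (ball p (barrierRadius lam ρ m) \ {p}) := by
  rintro x ⟨hx, hxp⟩
  set k : ℝ := m / log (ρ / barrierRadius lam ρ m)
  have hR : 0 < barrierRadius lam ρ m := pos_of_mem_ball hx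
  refine (harmonicAt_congr_nhds ?_).1 (HarmonicAt.add (harmonicAt_const_mul_log_norm_sub hxp k)
    (harmonicAt_const (-(k * log (barrierRadius lam ρ m)))))
  filter_upwards [isOpen_ball.mem_nhds hx, isOpen_ne.mem_nhds hxp] with z hz hzp
  have hpos : 0 < ‖z - p‖ := norm_pos_iff.2 (sub_ne_zero.2 hzp)
  rw [mem_ball, dist_eq_norm] at hz
  have hlog : log (‖z - p‖ / barrierRadius lam ρ m) ≤ 0 :=
    log_nonpos (by positivity) ((div_le_one hR).2 hz.le)
  rw [barrier, max_eq_left (mul_nonneg_of_nonpos_of_nonpos (barrier_coeff_nonpos hρ hm) hlog),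
    log_div hpos.ne' hR.ne', Pi.add_apply]
  ring

theorem viscositySubharmonicOn_neg_barrier (hp : p ∈ D) (hρ : 0 ≤ ρ) (hm : 0 ≤ m) :
    ViscositySubharmonicOn (-barrier lam p ρ m)
      (interior (closedBall p (barrierRadius lam ρ m)) \ closure D) := by
  rw [interior_closedBall']
  refine viscositySubharmonicOn_of_harmonicOnNhd
    ((harmonicOnNhd_barrier hρ hm).neg.mono fun x hx ↦ ⟨hx.1, ?_⟩)
  exact fun h ↦ hx.2 (subset_closure (h ▸ hp))

end Barrier

end OnePhaseFBP

end

theorem theorem3p5 (lam Lam : ℝ) (hlam : 0 < lam) (hLam : 0 < Lam) :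
    ∃ κ : ℝ, 0 < κ ∧
      ∀ (D : Set OnePhaseFBP.Plane) (f g : OnePhaseFBP.Plane → ℝ)
        (p : OnePhaseFBP.Plane) (ρ m : ℝ),
        IsOpen D → Bornology.IsBounded D →
        Continuous f → (∀ x, lam < f x ∧ f x < Lam) →
        ContinuousOn g (frontier D) → (∀ x ∈ frontier D, 0 < g x) →
        p ∈ D → D ⊆ Metric.ball p ρ → 0 < m →
        ∀ u : OnePhaseFBP.Plane → ℝ,
          u = OnePhaseFBP.largestSubsolution D f g (OnePhaseFBP.barrier lam p ρ m) →
          ∀ x₀ ∈ frontier (OnePhaseFBP.posSet D u), ∀ r : ℝ, 0 < r →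
            Disjoint (Metric.ball x₀ r) D →
            κ * r ≤ sSup (u '' Metric.ball x₀ r) := by
  refine ⟨√lam * Real.log 2 / 12800, by positivity, ?_⟩
  rintro D f g p ρ m hDo - - hf - - hp hDρ hm u rfl x₀ hx₀ r hr hD
  have hρ : 0 ≤ ρ := (Metric.pos_of_mem_ball (hDρ hp)).le
  exact OnePhaseFBP.theorem3p5_general hlam hDo (fun x ↦ (hf x).1.le) (convex_closedBall p _)
    Metric.isClosed_closedBall (OnePhaseFBP.continuousOn_barrier hp)
    (OnePhaseFBP.posSet_barrier_subset hρ hm.le)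
    (OnePhaseFBP.viscositySubharmonicOn_neg_barrier hp hρ hm.le) hx₀ hr hD
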